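/- **Theorem (Soundness of the mu-calculus proof system).** Fix a labeled transition system $(\mathcal S,\to)$, ${\to}\subseteq\mathcal S\times\Sigma\times\mathcal S$, and a valuation $\mathcal V:\mathrm{Var}\to 2^{\mathcal S}$, with $\mathrm{Var}$ countably infinite. If there is a successful tableau whose root is labeled by a sequent $S\vdash_{\varepsilon}\Phi$ with empty definition list, then this sequent is valid, i.e. $S\subseteq[\![\Phi]\!]_{\mathcal V}$. The notions are as follows. *Formulas.* $\Phi::=Z\mid\neg\Phi\mid\Phi\wedge\Phi\mid[K]\Phi\mid\nu Z.\Phi$ with $Z\in\mathrm{Var}$, $K\subseteq\Sigma$; a formula is well-formed if in each subformula $\nu Z.\Phi$ all free occurrences of $Z$ in $\Phi$ are under an even number of negations ($Z$ is positive in $\Phi$). Derived operators: $\Phi\vee\Psi=\neg(\neg\Phi\wedge\neg\Psi)$, $\langle K\rangle\Phi=\neg[K]\neg\Phi$, $\mu Z.\Phi=\neg\nu Z.\neg\Phi[Z:=\neg Z]$; $\sigma$ stands for $\mu$ or $\nu$. Write $s\xrightarrow{K}s'$ if $s\xrightarrow{a}s'$ for some $a\in K$. The semantics $[\![\Phi]\!]_{\mathcal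 V}\subseteq\mathcal S$ is the usual one, with $[\![[K]\Phi]\!]_{\mathcal V}=\{s\mid\forall s'.\ s\xrightarrow{K}s'\Rightarrow s'\in[\![\Phi]\!]_{\mathcal V}\}$ and $[\![\nu Z.\Phi]\!]_{\mathcal V}=\bigcup\{S\mid S\subseteq[\![\Phi]\!]_{\mathcal V[Z:=S]}\}$. A formula is in positive normal form if, written with the derived operators, it has negation on variables only. *Sequents.* A definition list is a finite sequence $\Delta=(U_1=\Phi_1)\cdots(U_n=\Phi_n)$ of distinct variables $U_i$ (definitional constants, forming $\mathrm{dom}\,\Delta$) and well-formed formulas such that no $U_i$ is bound in any $\Phi_j$ and $U_j$ is not free in $\Phi_i$ for $i\le j$. A sequent $S\vdash_\Delta\Phi$ consists of $S\subseteq\mathcal S$, a definition list $\Delta$ and a well-formed $\Phi$ in positive normal form in which every $U\in\mathrm{dom}\,\Delta$ is positive and not bound. It is valid if $S\subseteq[\![\Phi]\!]_{\mathcal V[\Delta]}$, where $\mathcal V[\varepsilon]=\mathcal V$ and $\mathcal V[(U=\Phi)\cdot\Delta]=(\mathcal V[U:=[\![\Phi]\!]_{\mathcal V}])[\Delta]$.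 *Rules* (goal / subgoals): - ($\wedge$) $S\vdash_\Delta\Phi_1\wedge\Phi_2$ / $S\vdash_\Delta\Phi_1$, $S\vdash_\Delta\Phi_2$; - ($\vee$) $S\vdash_\Delta\Phi_1\vee\Phi_2$ / $S_1\vdash_\Delta\Phi_1$, $S_2\vdash_\Delta\Phi_2$, with $S=S_1\cup S_2$; - ($[K]$) $S\vdash_\Delta[K]\Phi$ / $\{s'\mid\exists s\in S.\ s\xrightarrow{K}s'\}\vdash_\Delta\Phi$; - ($\langle K\rangle,f$) $S\vdash_\Delta\langle K\rangle\Phi$ / $f(S)\vdash_\Delta\Phi$, with $f:S\to\mathcal S$ such that $s\xrightarrow{K}f(s)$ for all $s\in S$; - ($\sigma Z$) $S\vdash_\Delta\sigma Z.\Phi$ / $S\vdash_{\Delta\cdot(U=\sigma Z.\Phi)}U$, with $U$ fresh: it occurs nowhere in the tableau outside the subtree rooted at this subgoal; - (Un) $S\vdash_\Delta U$ / $S\vdash_\Delta\Phi[Z:=U]$, where $\Delta(U)=\sigma Z.\Phi$; - (Thin) $S\vdash_\Delta\Phi$ / $S'\vdash_\Delta\Phi$, with $S\subseteq S'$. *Tableaux.*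 A tableau is a finite non-empty ordered tree whose nodes are labeled by sequents (over this transition system), with empty definition list at the root; to each internal node a rule is applied whose subgoals label its children from left to right, and each leaf is terminal. For a node $n$ write $\mathrm{st}(n)$ for the state set of its sequent. A *companion node* is a node to which Un is applied. A leaf $n$, labeled $S\vdash_\Delta\Phi$, is terminal if it is (a) a free leaf: $\Phi$ is $Z$ or $\neg Z$ with $Z\notin\mathrm{dom}\,\Delta$; or (b) a diamond leaf: $\Phi=\langle K\rangle\Psi$ and some $s\in S$ has no $s'$ with $s\xrightarrow{K}s'$; or (c) a $\sigma$-leaf: $\Phi=U\in\mathrm{dom}\,\Delta$ and there is a companion node $m$, a strict ancestor of $n$, with formula $U$ and $S\subseteq\mathrm{st}(m)$. The deepest such $m$ is the companion node of $n$, and $n$ is then a companion leaf of $m$. A $\sigma$-leaf is a $\mu$-leaf or a $\nu$-leaf according to whether $\Delta(U)$ is a $\mu$- or a $\nu$-formula. *Dependency orderings.* For a child $n'$ of $n$, $s'\in\mathrm{st}(n')$, $s\in\mathrm{st}(n)$: $s'<_{n',n}s$ iff $s\xrightarrow{K}s'$ if the rule applied to $n$ is $[K]$; $s'=f(s)$ if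 it is $(\langle K\rangle,f)$; $s'=s$ otherwise. Let $\lessdot$ be the least family with $s\lessdot_{n,n}s$ for $s\in\mathrm{st}(n)$, and $s'\lessdot_{n',n}s$ whenever $s'\lessdot_{n',m}s''$ and $s''<_{m,n}s$ for some $m,s''$. Let $<:_{n',n}$ (for nodes $n',n$) and $<:_m$ (for companion nodes $m$) be the least relations such that (i) $s'<:_{n',n}s$ whenever $s'\lessdot_{n',n}s$; (ii) $s'<:_{n',n}s$ whenever there are a companion node $m\ne n,n'$ and $t,t'\in\mathrm{st}(m)$ with $s'<:_{n',m}t'$, $t'<:_m^+t$ and $t\lessdot_{m,n}s$, where $<:_m^+$ is the transitive closure of $<:_m$; (iii) for $s,s'\in\mathrm{st}(m)$, $s'<:_m s$ whenever $s'<:_{m',m}s$ for some companion leaf $m'$ of $m$ with $s'\in\mathrm{st}(m')$. *Success.* A leaf labeled $S\vdash_\Delta\Phi$ is successful if $\Phi=Z\notin\mathrm{dom}\,\Delta$ and $S\subseteq\mathcal V(Z)$; or $\Phi=\neg Z$, $Z\notin\mathrm{dom}\,\Delta$ and $S\cap\mathcal V(Z)=\emptyset$; or it is a $\nu$-leaf;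 or it is a $\mu$-leaf with companion node $m$ such that $<:_m$ is well-founded, i.e. there is no infinite sequence $s_1,s_2,\dots$ with $s_{i+1}<:_m s_i$ for all $i$. A tableau is successful if all its leaves are successful. -/

import Mathlib

open Relation

universe u₁ u₂ u₃ u₄

namespace MuCalc

/-! ### Labeled transition systems -/

/-- A labeled transition system with state space `State` and sort (set of actions) `Act`. -/
structure LTS (State Act : Type*) where
  trans : State → Act → State → Prop

/-- `s --K--> s'`: some action of `K` leads from `s` to `s'`. -/
def LTS.step {State Act : Type*} (L : LTS State Act) (K : Set Act) (s s' : State) : Prop :=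
  ∃ a ∈ K, L.trans s a s'

/-- The states all of whose `K`-successors lie in `S`. -/
def LTS.predBox {State Act : Type*} (L : LTS State Act) (K : Set Act) (S : Set State) :
    Set State :=
  {s | ∀ s', L.step K s s' → s' ∈ S}

/-! ### Formulas -/

/-- Formulas of the propositional modal mu-calculus over actions `Act` and variables `Var`. -/
inductive Formula (Act Var : Type*) where
  | var (Z : Var) : Formula Act Var
  | neg (Φ : Formula Act Var) : Formula Act Var
  | and (Φ Ψ : Formula Act Var) : Formula Act Var
  | box (K : Set Act) (Φ : Formula Act Var) : Formula Act Var
  | nu (Z : Var) (Φ : Formula Act Var) : Formula Act Var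

namespace Formula

/-- The variables that occur free in a formula. -/
def free {Act Var : Type*} : Formula Act Var → Set Var
  | var Z => {Z}
  | neg Φ => free Φ
  | and Φ Ψ => free Φ ∪ free Ψ
  | box _ Φ => free Φ
  | nu Z Φ => free Φ \ {Z}

/-- The variables that are bound by some fixpoint operator inside a formula. -/
def bound {Act Var : Type*} : Formula Act Var → Set Var
  | var _ => ∅
  | neg Φ => bound Φ
  | and Φ Ψ => bound Φ ∪ bound Ψ
  | box _ Φ => bound Φ
  | nu Z Φ => insert Z (bound Φ)

/-- The variables that occur in a formula, free or bound. -/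
def occurs {Act Var : Type*} (Φ : Formula Act Var) : Set Var := Φ.free ∪ Φ.bound

/-- `Polarity true Z Φ`: every free occurrence of `Z` in `Φ` is inside the scope of an even number
of negations.  `Polarity false Z Φ`: the same with an odd number of negations. -/
def Polarity {Act Var : Type*} : Bool → Var → Formula Act Var → Prop
  | b, Z, var Y => Y = Z → b = true
  | b, Z, neg Φ => Polarity (!b) Z Φ
  | b, Z, and Φ Ψ => Polarity b Z Φ ∧ Polarity b Z Ψ
  | b, Z, box _ Φ => Polarity b Z Φ
  | b, Z, nu Y Φ => Y = Z ∨ Polarity b Z Φ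

/-- `Z` is positive in `Φ`. -/
def Positive {Act Var : Type*} (Z : Var) (Φ : Formula Act Var) : Prop := Polarity true Z Φ

/-- Well-formed formulas: in each subformula `νZ.Φ` the variable `Z` is positive in `Φ`. -/
def WellFormed {Act Var : Type*} : Formula Act Var → Prop
  | var _ => True
  | neg Φ => WellFormed Φ
  | and Φ Ψ => WellFormed Φ ∧ WellFormed Ψ
  | box _ Φ => WellFormed Φ
  | nu Z Φ => Positive Z Φ ∧ WellFormed Φ

/-- `subst Z Ψ Φ` is `Φ[Z := Ψ]`, the replacement of the free occurrences of `Z` in `Φ` by `Ψ`.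
No bound variable is renamed.  It is only applied where no capture can occur, so that it is the
capture-free substitution: with `Ψ = ¬Z` (in the definition of `mu`), and with `Ψ` a definitional
constant that is not bound in `Φ` (in the unfolding rule; see `IsDefList`). -/
def subst {Act Var : Type*} [DecidableEq Var] (Z : Var) (Ψ : Formula Act Var) :
    Formula Act Var → Formula Act Var
  | var Y => if Y = Z then Ψ else var Y
  | neg Φ => neg (subst Z Ψ Φ)
  | and Φ Φ' => and (subst Z Ψ Φ) (subst Z Ψ Φ')
  | box K Φ => box K (subst Z Ψ Φ)
  | nu Y Φ => if Y = Z then nu Y Φ else nu Y (subst Z Ψ Φ)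

/-- `Φ ∨ Ψ = ¬(¬Φ ∧ ¬Ψ)` -/
def or {Act Var : Type*} (Φ Ψ : Formula Act Var) : Formula Act Var := neg (and (neg Φ) (neg Ψ))

/-- `⟨K⟩Φ = ¬[K]¬Φ` -/
def dia {Act Var : Type*} (K : Set Act) (Φ : Formula Act Var) : Formula Act Var :=
  neg (box K (neg Φ))

/-- `μZ.Φ = ¬νZ.¬Φ[Z := ¬Z]` -/
def mu {Act Var : Type*} [DecidableEq Var] (Z : Var) (Φ : Formula Act Var) : Formula Act Var :=
  neg (nu Z (neg (subst Z (neg (var Z)) Φ)))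

/-- Positive normal form: the formula can be written with the derived dual operators in such a way
that negation is applied to variables only. -/
inductive PNF {Act Var : Type*} [DecidableEq Var] : Formula Act Var → Prop
  | var (Z : Var) : PNF (var Z)
  | negVar (Z : Var) : PNF (neg (Formula.var Z))
  | and {Φ Ψ : Formula Act Var} : PNF Φ → PNF Ψ → PNF (and Φ Ψ)
  | or {Φ Ψ : Formula Act Var} : PNF Φ → PNF Ψ → PNF (or Φ Ψ)
  | box (K : Set Act) {Φ : Formula Act Var} : PNF Φ → PNF (box K Φ)
  | dia (K : Set Act) {Φ : Formula Act Var} : PNF Φ → PNF (dia K Φ)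
  | nu (Z : Var) {Φ : Formula Act Var} : PNF Φ → PNF (nu Z Φ)
  | mu (Z : Var) {Φ : Formula Act Var} : PNF Φ → PNF (mu Z Φ)

/-- The set of states that satisfy `Φ` in the LTS `L` under the valuation `V`. -/
def sem {State Act Var : Type*} [DecidableEq Var] (L : LTS State Act) :
    Formula Act Var → (Var → Set State) → Set State
  | var Z, V => V Z
  | neg Φ, V => (sem L Φ V)ᶜ
  | and Φ Ψ, V => sem L Φ V ∩ sem L Ψ V
  | box K Φ, V => L.predBox K (sem L Φ V)
  | nu Z Φ, V => ⋃₀ {S | S ⊆ sem L Φ (Function.update V Z S)}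

end Formula

/-! ### Definition lists and sequents -/

/-- The definitional constants of a list of definitions `U = Φ`. -/
def domain {Act Var : Type*} (Δ : List (Var × Formula Act Var)) : Set Var :=
  {U | ∃ Φ, (U, Φ) ∈ Δ}

/-- Definition lists `(U₁ = Φ₁) ⋯ (Uₙ = Φₙ)`. -/
structure IsDefList {Act Var : Type*} (Δ : List (Var × Formula Act Var)) : Prop where
  wellFormed : ∀ d ∈ Δ, d.2.WellFormed
  distinct : ∀ i j : Fin Δ.length, i ≠ j → (Δ.get i).1 ≠ (Δ.get j).1
  not_bound : ∀ i j : Fin Δ.length, (Δ.get i).1 ∉ (Δ.get j).2.bound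
  not_free : ∀ i j : Fin Δ.length, i ≤ j → (Δ.get j).1 ∉ (Δ.get i).2.free

/-- `V[Δ]`, the extension of the valuation `V` by the definitions in `Δ`, from front to back. -/
def extend {State Act Var : Type*} [DecidableEq Var] (L : LTS State Act) :
    (Var → Set State) → List (Var × Formula Act Var) → (Var → Set State)
  | V, [] => V
  | V, (U, Φ) :: Δ => extend L (Function.update V U (Φ.sem L V)) Δ

/-- Sequents `S ⊢_Δ Φ`. -/
structure Sequent (State Act Var : Type*) [DecidableEq Var] where
  st : Set State
  dl : List (Var × Formula Act Var)
  fm : Formula Act Var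
  isDefList : IsDefList dl
  wellFormed : fm.WellFormed
  pnf : fm.PNF
  positive : ∀ U ∈ domain dl, fm.Positive U
  not_bound : ∀ U ∈ domain dl, U ∉ fm.bound

namespace Sequent

/-- The semantics `⟦Φ⟧_{V[Δ]}` of the sequent `S ⊢_Δ Φ`. -/
def sem {State Act Var : Type*} [DecidableEq Var] (L : LTS State Act) (V : Var → Set State)
    (q : Sequent State Act Var) : Set State :=
  q.fm.sem L (extend L V q.dl)

/-- A sequent is valid if all its states belong to its semantics. -/
def Valid {State Act Var : Type*} [DecidableEq Var] (L : LTS State Act) (V : Var → Set State)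
    (q : Sequent State Act Var) : Prop :=
  q.st ⊆ q.sem L V

/-- The variable `U` occurs somewhere in the sequent. -/
def Uses {State Act Var : Type*} [DecidableEq Var] (q : Sequent State Act Var) (U : Var) : Prop :=
  U ∈ q.fm.occurs ∨ ∃ d ∈ q.dl, d.1 = U ∨ U ∈ d.2.occurs

end Sequent

/-! ### Proof rules -/

/-- Rule applications.  An application of the diamond rule carries its witness function; only the
values of that function on the states of the goal sequent matter. -/
inductive RuleAppl (State Act : Type*) where
  | and : RuleAppl State Act
  | or : RuleAppl State Act
  | box (K : Set Act) : RuleAppl State Act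
  | dia (K : Set Act) (f : State → State) : RuleAppl State Act
  | mu : RuleAppl State Act
  | nu : RuleAppl State Act
  | un : RuleAppl State Act
  | thin : RuleAppl State Act

/-- `RuleOk L a q qs`: the goal `q` and the list `qs` of subgoals have the form, and satisfy the
side condition, of the rule application `a`.  The freshness condition of the fixpoint rules, which
concerns the whole proof, is stated in `PartialTableau`. -/
def RuleOk {State Act Var : Type*} [DecidableEq Var] (L : LTS State Act) :
    RuleAppl State Act → Sequent State Act Var → List (Sequent State Act Var) → Prop
  | .and, q, qs => ∃ q₁ q₂, qs = [q₁, q₂] ∧ q.fm = .and q₁.fm q₂.fm ∧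
      q₁.dl = q.dl ∧ q₂.dl = q.dl ∧ q₁.st = q.st ∧ q₂.st = q.st
  | .or, q, qs => ∃ q₁ q₂, qs = [q₁, q₂] ∧ q.fm = .or q₁.fm q₂.fm ∧
      q₁.dl = q.dl ∧ q₂.dl = q.dl ∧ q.st = q₁.st ∪ q₂.st
  | .box K, q, qs => ∃ q₁, qs = [q₁] ∧ q.fm = .box K q₁.fm ∧ q₁.dl = q.dl ∧
      q₁.st = {s' | ∃ s ∈ q.st, L.step K s s'}
  | .dia K f, q, qs => ∃ q₁, qs = [q₁] ∧ q.fm = .dia K q₁.fm ∧ q₁.dl = q.dl ∧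
      (∀ s ∈ q.st, L.step K s (f s)) ∧ q₁.st = f '' q.st
  | .mu, q, qs => ∃ q₁ U Z Φ, qs = [q₁] ∧ q.fm = .mu Z Φ ∧
      q₁.dl = q.dl ++ [(U, .mu Z Φ)] ∧ q₁.fm = .var U ∧ q₁.st = q.st
  | .nu, q, qs => ∃ q₁ U Z Φ, qs = [q₁] ∧ q.fm = .nu Z Φ ∧
      q₁.dl = q.dl ++ [(U, .nu Z Φ)] ∧ q₁.fm = .var U ∧ q₁.st = q.st
  | .un, q, qs => ∃ q₁ U Z Φ, qs = [q₁] ∧ q.fm = .var U ∧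
      ((U, .mu Z Φ) ∈ q.dl ∨ (U, .nu Z Φ) ∈ q.dl) ∧
      q₁.dl = q.dl ∧ q₁.fm = Formula.subst Z (.var U) Φ ∧ q₁.st = q.st
  | .thin, q, qs => ∃ q₁, qs = [q₁] ∧ q₁.fm = q.fm ∧ q₁.dl = q.dl ∧ q.st ⊆ q₁.st

/-! ### Finite ordered trees -/

/-- Finite non-empty ordered trees with node set `N`: a root, a partial parent function through
which every node reaches the root, and for every node an ordering of its children. -/
structure OrderedTree (N : Type*) where
  finite : Finite N
  root : N
  parent : N → Option N
  children : N → List N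
  parent_eq_none : ∀ n, parent n = none ↔ n = root
  reaches_root : ∀ n, ReflTransGen (fun a b => parent a = some b) n root
  nodup_children : ∀ n, (children n).Nodup
  mem_children : ∀ n n', n' ∈ children n ↔ parent n' = some n

namespace OrderedTree

def IsLeaf {N : Type*} (T : OrderedTree N) (n : N) : Prop := T.children n = []

/-- `m` is an ancestor of `n` (possibly `n` itself). -/
def Anc {N : Type*} (T : OrderedTree N) (m n : N) : Prop :=
  ReflTransGen (fun a b => T.parent a = some b) n m

/-- `m` is a strict ancestor of `n`. -/
def StrictAnc {N : Type*} (T : OrderedTree N) (m n : N) : Prop := T.Anc m n ∧ m ≠ n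

end OrderedTree

/-! ### Tableaux -/

/-- Partial tableaux with node set `N` for the LTS `L`. -/
structure PartialTableau {State Act : Type*} (Var : Type*) [DecidableEq Var] (N : Type*)
    (L : LTS State Act) where
  tree : OrderedTree N
  rule : N → Option (RuleAppl State Act)
  label : N → Sequent State Act Var
  rule_eq_none : ∀ n, rule n = none ↔ tree.IsLeaf n
  rule_ok : ∀ n a, rule n = some a → RuleOk L a (label n) ((tree.children n).map label)
  /-- Where a fixpoint rule introduces a constant `U`, this constant is fresh: it occurs nowhere in
  the tableau except at and below the node that is created by this application of the rule. -/
  fresh : ∀ n n', (rule n = some .mu ∨ rule n = some .nu) → n' ∈ tree.children n →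
    ∀ U Φ, (label n').dl = (label n).dl ++ [(U, Φ)] →
      ∀ m, (label m).Uses U → tree.Anc n' m

namespace PartialTableau

/-- The set of states of the sequent at node `n`. -/
def st {State Act Var N : Type*} [DecidableEq Var] {L : LTS State Act}
    (T : PartialTableau Var N L) (n : N) : Set State := (T.label n).st

/-- The definition list of the sequent at node `n`. -/
def dl {State Act Var N : Type*} [DecidableEq Var] {L : LTS State Act}
    (T : PartialTableau Var N L) (n : N) : List (Var × Formula Act Var) := (T.label n).dl

/-- The formula of the sequent at node `n`. -/
def fm {State Act Var N : Type*} [DecidableEq Var] {L : LTS State Act}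
    (T : PartialTableau Var N L) (n : N) : Formula Act Var := (T.label n).fm

/-- Companion nodes: the nodes to which the unfolding rule is applied. -/
def IsCompanionNode {State Act Var N : Type*} [DecidableEq Var] {L : LTS State Act}
    (T : PartialTableau Var N L) (m : N) : Prop := T.rule m = some .un

/-- `m` is a companion node strictly above the leaf `n`, it has the same definitional constant as
its formula, and its state set includes that of `n`. -/
def IsCandidate {State Act Var N : Type*} [DecidableEq Var] {L : LTS State Act}
    (T : PartialTableau Var N L) (m n : N) : Prop :=
  T.tree.IsLeaf n ∧ T.IsCompanionNode m ∧ T.tree.StrictAnc m n ∧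
    (∃ U ∈ domain (T.dl n), T.fm n = .var U ∧ T.fm m = .var U) ∧ T.st n ⊆ T.st m

/-- `m` is the companion node of the leaf `n`: the deepest of the candidates. -/
def IsCompanion {State Act Var N : Type*} [DecidableEq Var] {L : LTS State Act}
    (T : PartialTableau Var N L) (m n : N) : Prop :=
  T.IsCandidate m n ∧ ∀ m', T.IsCandidate m' n → T.tree.Anc m' m

/-- A `σ`-leaf is a leaf that has a companion node. -/
def IsSigmaLeaf {State Act Var N : Type*} [DecidableEq Var] {L : LTS State Act}
    (T : PartialTableau Var N L) (n : N) : Prop := ∃ m, T.IsCandidate m n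

/-- A `μ`-leaf is a `σ`-leaf whose constant is defined by a least fixpoint formula. -/
def IsMuLeaf {State Act Var N : Type*} [DecidableEq Var] {L : LTS State Act}
    (T : PartialTableau Var N L) (n : N) : Prop :=
  T.IsSigmaLeaf n ∧ ∃ U Z Φ, T.fm n = .var U ∧ (U, .mu Z Φ) ∈ T.dl n

/-- A `ν`-leaf is a `σ`-leaf whose constant is defined by a greatest fixpoint formula. -/
def IsNuLeaf {State Act Var N : Type*} [DecidableEq Var] {L : LTS State Act}
    (T : PartialTableau Var N L) (n : N) : Prop :=
  T.IsSigmaLeaf n ∧ ∃ U Z Φ, T.fm n = .var U ∧ (U, .nu Z Φ) ∈ T.dl n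

/-- A free leaf is a leaf whose formula is `Z` or `¬Z` with `Z` not a definitional constant. -/
def IsFreeLeaf {State Act Var N : Type*} [DecidableEq Var] {L : LTS State Act}
    (T : PartialTableau Var N L) (n : N) : Prop :=
  T.tree.IsLeaf n ∧ ∃ Z, Z ∉ domain (T.dl n) ∧ (T.fm n = .var Z ∨ T.fm n = .neg (.var Z))

/-- A diamond leaf is a leaf with formula `⟨K⟩Φ` one of whose states has no `K`-successor. -/
def IsDiamondLeaf {State Act Var N : Type*} [DecidableEq Var] {L : LTS State Act}
    (T : PartialTableau Var N L) (n : N) : Prop :=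
  T.tree.IsLeaf n ∧ ∃ K Φ, T.fm n = .dia K Φ ∧ ∃ s ∈ T.st n, ¬ ∃ s', L.step K s s'

/-- A (complete) tableau: the definition list of the root is empty and all leaves are terminal. -/
def IsTableau {State Act Var N : Type*} [DecidableEq Var] {L : LTS State Act}
    (T : PartialTableau Var N L) : Prop :=
  T.dl T.tree.root = [] ∧
    ∀ n, T.tree.IsLeaf n → T.IsFreeLeaf n ∨ T.IsDiamondLeaf n ∨ T.IsSigmaLeaf n

/-! ### Dependency orderings -/

/-- The local dependency ordering: `LocalDep T n' n s' s` is `s' <_{n',n} s`. -/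
def LocalDep {State Act Var N : Type*} [DecidableEq Var] {L : LTS State Act}
    (T : PartialTableau Var N L) (n' n : N) (s' s : State) : Prop :=
  n' ∈ T.tree.children n ∧ s' ∈ T.st n' ∧ s ∈ T.st n ∧
    match T.rule n with
    | none => False
    | some (.box K) => L.step K s s'
    | some (.dia _ f) => s' = f s
    | some _ => s = s'

/-- The dependency ordering: `Dep T n' s' n s` is `s' ⋖_{n',n} s`. -/
inductive Dep {State Act Var N : Type*} [DecidableEq Var] {L : LTS State Act}
    (T : PartialTableau Var N L) : N → State → N → State → Prop
  | refl {n : N} {s : State} : s ∈ T.st n → Dep T n s n s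
  | step {n' m n : N} {s' s'' s : State} :
      Dep T n' s' m s'' → LocalDep T m n s'' s → Dep T n' s' n s

mutual

/-- The extended dependency ordering: `ExtDep T n' s' n s` is `s' <:_{n',n} s`. -/
inductive ExtDep {State : Type u₁} {Act : Type u₂} {Var : Type u₃} {N : Type u₄}
    [DecidableEq Var] {L : LTS State Act} (T : PartialTableau Var N L) :
    N → State → N → State → Prop
  | base {n' n : N} {s' s : State} : Dep T n' s' n s → ExtDep T n' s' n s
  | step {n' m n : N} {s' t' t s : State} : IsCompanionNode T m → m ≠ n → m ≠ n' →
      t ∈ T.st m → t' ∈ T.st m →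
      ExtDep T n' s' m t' → CompDepPlus T m t' t → Dep T m t n s → ExtDep T n' s' n s

/-- The companion-node ordering: `CompDep T m s' s` is `s' <:_m s`. -/
inductive CompDep {State : Type u₁} {Act : Type u₂} {Var : Type u₃} {N : Type u₄}
    [DecidableEq Var] {L : LTS State Act} (T : PartialTableau Var N L) :
    N → State → State → Prop
  | intro {m m' : N} {s' s : State} : IsCompanionNode T m → s ∈ T.st m → s' ∈ T.st m →
      IsCompanion T m m' → s' ∈ T.st m' → ExtDep T m' s' m s → CompDep T m s' s

/-- The transitive closure of the companion-node ordering: `CompDepPlus T m t' t` is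
`t' <:_m⁺ t` (see `compDepPlus_iff`). -/
inductive CompDepPlus {State : Type u₁} {Act : Type u₂} {Var : Type u₃} {N : Type u₄}
    [DecidableEq Var] {L : LTS State Act} (T : PartialTableau Var N L) :
    N → State → State → Prop
  | single {m : N} {t' t : State} : CompDep T m t' t → CompDepPlus T m t' t
  | tail {m : N} {t'' t' t : State} :
      CompDepPlus T m t'' t' → CompDep T m t' t → CompDepPlus T m t'' t

end

theorem compDepPlus_iff {State Act Var N : Type*} [DecidableEq Var] {L : LTS State Act}
    (T : PartialTableau Var N L) (m : N) (t' t : State) :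
    CompDepPlus T m t' t ↔ TransGen (CompDep T m) t' t := by
  constructor
  · intro h
    refine CompDepPlus.rec (motive_1 := fun _ _ _ _ _ => True) (motive_2 := fun _ _ _ _ => True)
      (motive_3 := fun m t' t _ => TransGen (CompDep T m) t' t)
      ?_ ?_ ?_ ?_ ?_ h
    · intros; trivial
    · intros; trivial
    · intros; trivial
    · intro m t' t h _
      exact TransGen.single h
    · intro m t'' t' t _ h ih _
      exact TransGen.tail ih h
  · intro h
    induction h with
    | single h => exact .single h
    | tail _ h ih => exact .tail ih h

/-! ### Success -/

/-- Successful leaves. -/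
def IsSuccessfulLeaf {State Act Var N : Type*} [DecidableEq Var] {L : LTS State Act}
    (T : PartialTableau Var N L) (V : Var → Set State) (n : N) : Prop :=
  (∃ Z, Z ∉ domain (T.dl n) ∧ T.fm n = .var Z ∧ T.st n ⊆ V Z) ∨
  (∃ Z, Z ∉ domain (T.dl n) ∧ T.fm n = .neg (.var Z) ∧ T.st n ∩ V Z = ∅) ∨
  T.IsNuLeaf n ∨
  (T.IsMuLeaf n ∧ ∃ m, T.IsCompanion m n ∧ WellFounded (T.CompDep m))

/-- A successful tableau, for the valuation `V`: a tableau all of whose leaves are successful. -/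
def IsSuccessful {State Act Var N : Type*} [DecidableEq Var] {L : LTS State Act}
    (T : PartialTableau Var N L) (V : Var → Set State) : Prop :=
  T.IsTableau ∧ ∀ n, T.tree.IsLeaf n → T.IsSuccessfulLeaf V n

end PartialTableau

end MuCalc

-- Soundness is proved by following a counterexample. Suppose a state of the root violates its
-- formula. Every rule is locally sound, so a violating state of a goal yields a violating state of
-- some subgoal, related to it by the local dependency ordering. At a leaf of a successful tableau
-- the violation must concern a constant `U`, since free leaves are evaluated exactly; it then
-- persists at the companion node, where the walk resumes. The result is an infinite path of refuted
-- states (`exists_traceStep`).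
--
-- To measure progress on greatest fixpoints, each ν-constant is read as an ordinal approximant,
-- while μ-constants keep their exact semantics. Introducing a ν-constant chooses an ordinal whose
-- approximant already excludes the state; unfolding it strictly lowers that ordinal, and no other
-- step raises it.
--
-- Since the tree is finite, a topmost node `m` among those visited infinitely often exists, and
-- from some moment on the path stays at or below `m` (`exists_recurrent_node`). The node `m` is the
-- companion of some leaf. If its constant is a ν-constant, freshness forbids reintroducing it below
-- `m`, so its ordinal never rises and falls at each visit: impossible. If it is a μ-constant, the
-- states at successive visits descend in the transitive closure of the ordering of `m`
-- (`compDepPlus_of_path`), against well-foundedness. This last lemma is the combinatorial core: the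
-- extended orderings capture all paths, because a path decomposes at each node into loops through
-- that node and a path strictly below it.

namespace MuCalc

-- Ancestors in finite trees

namespace OrderedTree

variable {N : Type*} (T : OrderedTree N)

/-- Rotating a cycle by one step gives a cycle through the parent, so any cycle would climb to the
root, which has no parent. -/
theorem not_transGen_self (n : N) : ¬ TransGen (fun a b => T.parent a = some b) n n := by
  induction T.reaches_root n using ReflTransGen.head_induction_on with
  | refl =>
    intro h
    obtain ⟨b, hb, -⟩ := TransGen.head'_iff.1 h
    rw [(T.parent_eq_none _).2 rfl] at hb
    cases hb
  | head hp _ ih =>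
    intro h
    obtain ⟨b, hb, hbn⟩ := TransGen.head'_iff.1 h
    rw [hp] at hb
    cases hb
    exact ih (TransGen.tail' hbn hp)

variable {T}

theorem Anc.trans {a b c : N} (h : T.Anc a b) (h' : T.Anc b c) : T.Anc a c :=
  ReflTransGen.trans h' h

theorem Anc.antisymm {a b : N} (h : T.Anc a b) (h' : T.Anc b a) : a = b := by
  rcases reflTransGen_iff_eq_or_transGen.1 h with h | h
  · exact h
  · exact absurd (TransGen.trans_left h h') (T.not_transGen_self _)

theorem Anc.total {a b c : N} (h : T.Anc a c) (h' : T.Anc b c) : T.Anc a b ∨ T.Anc b a := by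
  have := ReflTransGen.total_of_right_unique (r := fun a b => T.parent a = some b)
    (fun x y z hy hz => Option.some.inj (hy.symm.trans hz)) h h'
  exact this.symm

theorem anc_of_mem_children {n n' : N} (h : n' ∈ T.children n) : T.Anc n n' :=
  ReflTransGen.single ((T.mem_children _ _).1 h)

theorem not_anc_of_mem_children {n n' : N} (h : n' ∈ T.children n) : ¬ T.Anc n' n := fun h' =>
  T.not_transGen_self _ (TransGen.head' ((T.mem_children _ _).1 h) h')

/-- An ancestor of a child is the child itself or an ancestor of the parent. -/
theorem Anc.eq_or_anc_parent {a n n' : N} (h : T.Anc a n') (hn : n' ∈ T.children n) :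
    a = n' ∨ T.Anc a n := by
  rcases ReflTransGen.cases_head h with h | ⟨b, hb, hba⟩
  · exact .inl h.symm
  · rw [(T.mem_children _ _).1 hn] at hb
    cases hb
    exact .inr hba

variable (T)

theorem wellFounded_children : WellFounded (fun n' n => n' ∈ T.children n) := by
  have := T.finite
  have : Std.Irrefl (TransGen (fun a b => T.parent a = some b)) := ⟨T.not_transGen_self⟩
  refine Subrelation.wf (r := TransGen (fun a b => T.parent a = some b)) ?_
    (Finite.wellFounded_of_trans_of_irrefl _)
  intro a b h
  exact .single ((T.mem_children _ _).1 h)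

/-- A nonempty set of nodes has a member without strict ancestors in the set. -/
theorem exists_topmost {p : N → Prop} (h : ∃ n, p n) : ∃ m, p m ∧ ∀ n, p n → T.Anc n m → n = m := by
  have := T.finite
  have hi : Std.Irrefl (TransGen (flip fun a b => T.parent a = some b)) :=
    ⟨fun n hn => T.not_transGen_self n (transGen_swap.1 hn)⟩
  obtain ⟨m, hm, hmin⟩ := (Finite.wellFounded_of_trans_of_irrefl
    (TransGen (flip fun a b => T.parent a = some b))).has_min {n | p n} h
  refine ⟨m, hm, fun n hn hnm => ?_⟩
  rcases reflTransGen_iff_eq_or_transGen.1 hnm with h | h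
  · exact h
  · exact absurd (transGen_swap.2 h) (hmin n hn)

/-- Among the ancestors of a node that have a given property there is a deepest one. -/
theorem exists_deepest {p : N → Prop} {l : N} (hp : ∀ n, p n → T.Anc n l) (h : ∃ n, p n) :
    ∃ m, p m ∧ ∀ n, p n → T.Anc n m := by
  have := T.finite
  have hi : Std.Irrefl (TransGen (fun a b => T.parent a = some b)) := ⟨T.not_transGen_self⟩
  obtain ⟨m, hm, hmin⟩ := (Finite.wellFounded_of_trans_of_irrefl
    (TransGen (fun a b => T.parent a = some b))).has_min {n | p n} h
  refine ⟨m, hm, fun n hn => ?_⟩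
  rcases (hp n hn).total (hp m hm) with h | h
  · exact h
  · rcases reflTransGen_iff_eq_or_transGen.1 h with rfl | h
    · exact .refl
    · exact absurd h (hmin n hn)

end OrderedTree

-- Semantics: substitution, monotonicity, unfolding

namespace Formula

variable {State Act Var : Type*} [DecidableEq Var] (L : LTS State Act)

/-- The semantics depends only on the values of the free variables. -/
theorem sem_congr {Φ : Formula Act Var} {V W : Var → Set State} (h : ∀ Y ∈ Φ.free, V Y = W Y) :
    Φ.sem L V = Φ.sem L W := by
  induction Φ generalizing V W with
  | var Z => exact h Z rfl
  | neg Φ ih => simp only [sem, ih h]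
  | and Φ Ψ ih ih' =>
    simp only [sem, ih fun Y hY => h Y (.inl hY), ih' fun Y hY => h Y (.inr hY)]
  | box K Φ ih => simp only [sem, ih h]
  | nu Z Φ ih =>
    simp only [sem]
    congr 1
    ext S
    rw [Set.mem_ofPred_eq, Set.mem_ofPred_eq, ih (W := Function.update W Z S)]
    intro Y hY
    by_cases hYZ : Y = Z
    · subst hYZ; simp
    · simpa [hYZ] using h Y ⟨hY, hYZ⟩

/-- The substitution lemma. -/
theorem sem_subst {Z : Var} {Ψ Φ : Formula Act Var} (h : ∀ Y ∈ Ψ.free, Y ∈ Φ.bound → Y = Z)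
    (V : Var → Set State) :
    (subst Z Ψ Φ).sem L V = Φ.sem L (Function.update V Z (Ψ.sem L V)) := by
  induction Φ generalizing V with
  | var Y =>
    by_cases hY : Y = Z
    · subst hY; simp [subst, sem]
    · simp [subst, sem, hY]
  | neg Φ ih => simp only [subst, sem, ih h]
  | and Φ Φ' ih ih' =>
    simp only [subst, sem, ih fun Y hY hb => h Y hY (.inl hb),
      ih' fun Y hY hb => h Y hY (.inr hb)]
  | box K Φ ih => simp only [subst, sem, ih h]
  | nu Y Φ ih =>
    by_cases hY : Y = Z
    · subst hY; simp [subst, sem]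
    -- A binder of `Z` itself is harmless because substitution stops there. Any other binder in `Φ`
    -- is not free in `Ψ`, so nothing is captured.
    · have hf : Y ∉ Ψ.free := fun hf => hY (h Y hf (.inl rfl))
      simp only [subst, hY, if_false, sem]
      congr 1
      ext S
      rw [Set.mem_ofPred_eq, Set.mem_ofPred_eq, ih fun X hX hb => h X hX (.inr hb),
        sem_congr L (Φ := Ψ) (W := V), Function.update_comm hY]
      intro X hX
      have : X ≠ Y := by rintro rfl; exact hf hX
      simp [this]

theorem bound_subst {Z : Var} {Ψ : Formula Act Var} (h : Ψ.bound = ∅) (Φ : Formula Act Var) :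
    (subst Z Ψ Φ).bound = Φ.bound := by
  induction Φ with
  | var Y => by_cases hY : Y = Z <;> simp [subst, hY, h, bound]
  | neg Φ ih => simpa only [subst, bound] using ih
  | and Φ Φ' ih ih' => simp only [subst, bound, ih, ih']
  | box K Φ ih => simpa only [subst, bound] using ih
  | nu Y Φ ih => by_cases hY : Y = Z <;> simp [subst, hY, bound, ih]

/-- The semantics is monotone in positive variables and antitone in negative ones. -/
theorem sem_update_mono {Z : Var} {Φ : Formula Act Var} {b : Bool} (h : Polarity b Z Φ)
    (V : Var → Set State) {A B : Set State} (hAB : if b then A ⊆ B else B ⊆ A) :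
    Φ.sem L (Function.update V Z A) ⊆ Φ.sem L (Function.update V Z B) := by
  induction Φ generalizing b V A B with
  | var Y =>
    by_cases hY : Y = Z
    · subst hY
      have := h rfl
      subst this
      simpa [sem] using hAB
    · simp [sem, hY]
  | neg Φ ih =>
    refine Set.compl_subset_compl.2 (ih h V ?_)
    cases b <;> simpa using hAB
  | and Φ Ψ ih ih' => exact Set.inter_subset_inter (ih h.1 V hAB) (ih' h.2 V hAB)
  | box K Φ ih => exact fun s hs s' hs' => ih h V hAB (hs s' hs')
  | nu Y Φ ih =>
    by_cases hY : Y = Z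
    · subst hY; simp [sem]
    · refine Set.sUnion_subset_sUnion fun S hS => ?_
      rw [Set.mem_ofPred_eq, Function.update_comm (Ne.symm hY)] at hS ⊢
      exact hS.trans (ih (h.resolve_left hY) _ hAB)

/-- A least fixpoint formula is implied by its unfolding. -/
theorem sem_update_mu_subset {Z : Var} {Φ : Formula Act Var} (h : (mu Z Φ).WellFormed)
    (V : Var → Set State) :
    Φ.sem L (Function.update V Z ((mu Z Φ).sem L V)) ⊆ (mu Z Φ).sem L V := by
  rintro s hs ⟨S, hS, hsS⟩
  -- The least fixpoint is the complement of the greatest fixpoint of the dual body, so a post-fixed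
  -- set `S` of that body avoids it. Positivity lets `S` grow to the whole complement, at which the
  -- dual body is the negation of `Φ` evaluated at the least fixpoint.
  have hsub : S ⊆ ((mu Z Φ).sem L V)ᶜ := by
    intro x hx
    simp only [mu, sem, compl_compl]
    exact ⟨S, hS, hx⟩
  have := (hS.trans (sem_update_mono L h.1 V (b := true) hsub)) hsS
  refine this ?_
  rw [sem_subst L (by simp [free])]
  simpa [sem] using hs

end Formula

/-! ### Definition lists -/

section DefList

variable {Act Var : Type*}

theorem domain_cons (U : Var) (Φ : Formula Act Var) (Δ : List (Var × Formula Act Var)) :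
    domain ((U, Φ) :: Δ) = insert U (domain Δ) := by
  ext Y
  simp only [domain, Set.mem_ofPred_eq, List.mem_cons, Prod.mk.injEq, Set.mem_insert_iff]
  constructor
  · rintro ⟨Ψ, ⟨rfl, rfl⟩ | h⟩
    · exact .inl rfl
    · exact .inr ⟨Ψ, h⟩
  · rintro (rfl | ⟨Ψ, h⟩)
    · exact ⟨Φ, .inl ⟨rfl, rfl⟩⟩
    · exact ⟨Ψ, .inr h⟩

theorem IsDefList.notMem_domain_of_append {Δ Δ' : List (Var × Formula Act Var)}
    (h : IsDefList (Δ ++ Δ')) {U : Var} (hU : U ∈ domain Δ) : U ∉ domain Δ' := by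
  obtain ⟨Φ, hΦ⟩ := hU
  rintro ⟨Ψ, hΨ⟩
  obtain ⟨i, hi, hi'⟩ := List.getElem_of_mem hΦ
  obtain ⟨j, hj, hj'⟩ := List.getElem_of_mem hΨ
  refine h.distinct ⟨i, by simp; omega⟩ ⟨Δ.length + j, by simpa using hj⟩
    (by simp [Fin.ext_iff]; omega) ?_
  simp [List.getElem_append_left hi, hi', hj']

theorem IsDefList.tail {d : Var × Formula Act Var} {Δ : List (Var × Formula Act Var)}
    (h : IsDefList (d :: Δ)) : IsDefList Δ where
  wellFormed e he := h.wellFormed e (.tail _ he)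
  distinct i j hij := h.distinct i.succ j.succ (by simpa using hij)
  not_bound i j := h.not_bound i.succ j.succ
  not_free i j hij := h.not_free i.succ j.succ (by simpa using hij)

theorem IsDefList.notMem_bound {Δ : List (Var × Formula Act Var)} (h : IsDefList Δ)
    {d e : Var × Formula Act Var} (hd : d ∈ Δ) (he : e ∈ Δ) : d.1 ∉ e.2.bound := by
  obtain ⟨i, rfl⟩ := List.get_of_mem hd
  obtain ⟨j, rfl⟩ := List.get_of_mem he
  exact h.not_bound i j

theorem IsDefList.notMem_free_head {d : Var × Formula Act Var} {Δ : List (Var × Formula Act Var)}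
    (h : IsDefList (d :: Δ)) {U : Var} (hU : U ∈ domain (d :: Δ)) : U ∉ d.2.free := by
  obtain ⟨Φ, hΦ⟩ := hU
  obtain ⟨j, hj⟩ := List.get_of_mem hΦ
  have := h.not_free 0 j (Fin.zero_le _)
  rw [hj] at this
  exact this

theorem IsDefList.eq_of_mem {Δ : List (Var × Formula Act Var)} (h : IsDefList Δ)
    {U : Var} {Φ Ψ : Formula Act Var} (hΦ : (U, Φ) ∈ Δ) (hΨ : (U, Ψ) ∈ Δ) : Φ = Ψ := by
  obtain ⟨i, hi⟩ := List.get_of_mem hΦ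
  obtain ⟨j, hj⟩ := List.get_of_mem hΨ
  by_cases hij : i = j
  · subst hij
    exact congrArg Prod.snd (hi.symm.trans hj)
  · exact absurd (by rw [hi, hj]) (h.distinct i j hij)

end DefList

/-! ### Approximants of greatest fixpoints -/

section Approx

universe u

variable {State : Type u}

/-- The ordinal approximants of the greatest fixpoint of `F`. -/
noncomputable def approx (F : Set State → Set State) (o : Ordinal.{u}) : Set State :=
  ⋂ b : Set.Iio o, F (approx F b)
termination_by o
decreasing_by exact b.2

theorem notMem_approx {F : Set State → Set State} {o : Ordinal.{u}} {s : State} :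
    s ∉ approx F o ↔ ∃ b < o, s ∉ F (approx F b) := by
  rw [approx]
  simp

/-- A state that belongs to no post-fixed point is excluded by some approximant. -/
theorem exists_notMem_approx {F : Set State → Set State} {s : State}
    (hs : s ∉ ⋃₀ {S | S ⊆ F S}) : ∃ o : Ordinal.{u}, s ∉ approx F o := by
  by_contra! hall
  -- Each state that is ever excluded gets an ordinal excluding it. The supremum of these exists
  -- because the ordinals live in the universe of `State`.
  have hex : ∀ x : State, ∃ o : Ordinal.{u}, (∃ o', x ∉ approx F o') → x ∉ approx F o := fun x => by
    by_cases h : ∃ o' : Ordinal.{u}, x ∉ approx F o'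
    · exact ⟨h.choose, fun _ => h.choose_spec⟩
    · exact ⟨0, fun h' => absurd h' h⟩
  choose g hg using hex
  have hx : ∀ x ∈ approx F (⨆ x, g x), ∀ o, x ∈ approx F o := by
    intro x hx
    by_contra! h
    obtain ⟨b, hb, hxb⟩ := notMem_approx.1 (hg x h)
    exact notMem_approx.2 ⟨b, hb.trans_le (Ordinal.le_iSup g x), hxb⟩ hx
  -- At the supremum the approximants have stabilized, so this one is a post-fixed point.
  -- Approximants decrease by construction as intersections; monotonicity of `F` plays no role.
  refine hs ⟨approx F (⨆ x, g x), fun x hxO => ?_, hall _⟩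
  by_contra h
  exact notMem_approx.2 ⟨_, Order.lt_succ _, h⟩ (hx x hxO (Order.succ (⨆ x, g x)))

variable {Act Var : Type*} [DecidableEq Var] (L : LTS State Act)

/-- The semantics of a definition, with an outermost greatest fixpoint replaced by its approximant
at `o`. -/
noncomputable def approxSem (o : Ordinal.{u}) (V : Var → Set State) : Formula Act Var → Set State
  | .nu Z Φ => approx (fun S => Φ.sem L (Function.update V Z S)) o
  -- Least fixpoint formulas are negations and fall under this case, so the ordinal is irrelevant
  -- for them.
  | Φ => Φ.sem L V

/-- The extension of `V` by the definitions in `Δ`, where the constant `U` of a greatest fixpoint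
formula stands for the approximant at `α U`. -/
noncomputable def approxExtend (α : Var → Ordinal.{u}) :
    (Var → Set State) → List (Var × Formula Act Var) → (Var → Set State)
  | V, [] => V
  | V, (U, Φ) :: Δ => approxExtend α (Function.update V U (approxSem L (α U) V Φ)) Δ

theorem approxExtend_append (α : Var → Ordinal.{u}) (V : Var → Set State)
    (Δ Δ' : List (Var × Formula Act Var)) :
    approxExtend L α V (Δ ++ Δ') = approxExtend L α (approxExtend L α V Δ) Δ' := by
  induction Δ generalizing V with
  | nil => rfl
  | cons d Δ ih => exact ih _

theorem approxExtend_of_notMem (α : Var → Ordinal.{u}) (V : Var → Set State)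
    {Δ : List (Var × Formula Act Var)} {Y : Var} (h : Y ∉ domain Δ) :
    approxExtend L α V Δ Y = V Y := by
  induction Δ generalizing V with
  | nil => rfl
  | cons d Δ ih =>
    rw [domain_cons, Set.mem_insert_iff, not_or] at h
    rw [approxExtend, ih _ h.2, Function.update_of_ne h.1]

theorem approxExtend_congr {α α' : Var → Ordinal.{u}} (V : Var → Set State)
    {Δ : List (Var × Formula Act Var)} (h : ∀ U ∈ domain Δ, α U = α' U) :
    approxExtend L α V Δ = approxExtend L α' V Δ := by
  induction Δ generalizing V with
  | nil => rfl
  | cons d Δ ih =>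
    rw [domain_cons] at h
    rw [approxExtend, approxExtend, h d.1 (.inl rfl), ih _ fun U hU => h U (.inr hU)]

/-- A defined constant stands for its definition; the valuation of the free variables of the
definition does not depend on the approximant chosen for the constant. -/
theorem approxExtend_of_mem (α : Var → Ordinal.{u}) (V : Var → Set State)
    {Δ : List (Var × Formula Act Var)} (h : IsDefList Δ) {U : Var} {Φ : Formula Act Var}
    (hU : (U, Φ) ∈ Δ) : ∃ W : Var → Set State, ∀ o,
      (∀ Y ∈ Φ.free, approxExtend L (Function.update α U o) V Δ Y = W Y) ∧
        approxExtend L (Function.update α U o) V Δ U = approxSem L o W Φ := by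
  induction Δ generalizing V with
  | nil => cases hU
  | cons d Δ ih =>
    have hnot : d.1 ∉ domain Δ :=
      h.notMem_domain_of_append (Δ := [d]) (Δ' := Δ) ⟨d.2, by simp⟩
    rcases List.mem_cons.1 hU with rfl | hU'
    · refine ⟨V, fun o => ⟨fun Y hY => ?_, ?_⟩⟩
      -- Neither the constant itself nor any later one is free in its definition, so `V` already
      -- determines the relevant values.
      · exact approxExtend_of_notMem L _ _ fun hY' => h.notMem_free_head hY' hY
      · rw [approxExtend, approxExtend_of_notMem L _ _ hnot]
        simp
    · have hne : d.1 ≠ U := by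
        rintro rfl
        exact hnot ⟨Φ, hU'⟩
      obtain ⟨W, hW⟩ := ih (Function.update V d.1 (approxSem L (α d.1) V d.2)) h.tail hU'
      refine ⟨W, fun o => ?_⟩
      rw [approxExtend, Function.update_of_ne hne]
      exact hW o

/-- A μ-constant denotes its exact fixpoint, which contains its own unfolding; hence refutation
passes to the unfolding with unchanged ordinals. -/
theorem notMem_unfold_mu (α : Var → Ordinal.{u}) (V : Var → Set State)
    {Δ : List (Var × Formula Act Var)} (h : IsDefList Δ) {U Z : Var} {Φ : Formula Act Var}
    (hU : (U, .mu Z Φ) ∈ Δ) {s : State} (hs : s ∉ approxExtend L α V Δ U) :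
    s ∉ (Formula.subst Z (.var U) Φ).sem L (approxExtend L α V Δ) := by
  obtain ⟨W, hW⟩ := approxExtend_of_mem L α V h hU
  have hW := hW (α U)
  rw [Function.update_eq_self] at hW
  have hUW : approxExtend L α V Δ U = (Formula.mu Z Φ).sem L (approxExtend L α V Δ) := by
    rw [hW.2]
    exact (Formula.sem_congr L hW.1).symm
  have hb := h.notMem_bound hU hU
  simp only [Formula.mu, Formula.bound, Formula.bound_subst (Ψ := .neg (.var Z)) rfl] at hb
  rw [Formula.sem_subst L (by rintro Y rfl hY; exact absurd (.inr hY) hb)]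
  intro hs'
  refine hs ?_
  rw [hUW]
  refine Formula.sem_update_mu_subset L (h.wellFormed _ hU) _ ?_
  rwa [Formula.sem, hUW] at hs'

/-- The approximant at `α U` is an intersection over smaller ordinals, so an excluded state is
already excluded by one application of the body at some smaller `o`. Resetting `U` to `o` may also
alter later constants, but none of them is free in the definition of `U`. -/
theorem notMem_unfold_nu (α : Var → Ordinal.{u}) (V : Var → Set State)
    {Δ : List (Var × Formula Act Var)} (h : IsDefList Δ) {U Z : Var} {Φ : Formula Act Var}
    (hU : (U, .nu Z Φ) ∈ Δ) {s : State} (hs : s ∉ approxExtend L α V Δ U) :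
    ∃ o < α U, s ∉ (Formula.subst Z (.var U) Φ).sem L
      (approxExtend L (Function.update α U o) V Δ) := by
  obtain ⟨W, hW⟩ := approxExtend_of_mem L α V h hU
  have hWα := hW (α U)
  rw [Function.update_eq_self] at hWα
  rw [hWα.2] at hs
  obtain ⟨o, ho, hso⟩ := notMem_approx.1 hs
  refine ⟨o, ho, ?_⟩
  have hb := h.notMem_bound hU hU
  rw [Formula.sem_subst L (by rintro Y rfl hY; exact absurd (.inr hY) hb), Formula.sem, (hW o).2]
  convert hso using 2
  refine Formula.sem_congr L fun Y hY => ?_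
  by_cases hYZ : Y = Z
  · subst hYZ; simp [approxSem]
  · simpa [hYZ] using (hW o).1 Y ⟨hY, hYZ⟩

end Approx

namespace PartialTableau

/-! ### Paths through a tableau and the companion-node orderings -/

section Paths

variable {State Act Var N : Type*} [DecidableEq Var] {L : LTS State Act}
  (T : PartialTableau Var N L)

/-- One step of a path: to a child along the local dependency ordering, or from a leaf to its
companion node. -/
def PathStep (c c' : N × State) : Prop :=
  T.LocalDep c'.1 c.1 c'.2 c.2 ∨ (T.IsCompanion c'.1 c.1 ∧ c'.2 = c.2 ∧ c.2 ∈ T.st c.1)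

variable {T}

theorem IsCompanionNode.not_isLeaf {m : N} (h : T.IsCompanionNode m) : ¬ T.tree.IsLeaf m := by
  intro hl
  rw [← T.rule_eq_none] at hl
  rw [IsCompanionNode, hl] at h
  cases h

theorem IsCompanion.isLeaf {m l : N} (h : T.IsCompanion m l) : T.tree.IsLeaf l := h.1.1

theorem IsCompanion.isCompanionNode {m l : N} (h : T.IsCompanion m l) : T.IsCompanionNode m :=
  h.1.2.1

theorem IsCompanion.anc {m l : N} (h : T.IsCompanion m l) : T.tree.Anc m l := h.1.2.2.1.1

theorem IsCompanion.unique {m m' l : N} (h : T.IsCompanion m l) (h' : T.IsCompanion m' l) :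
    m = m' :=
  (h'.2 m h.1).antisymm (h.2 m' h'.1)

theorem Dep.anc {n' n : N} {s' s : State} (h : Dep T n' s' n s) : T.tree.Anc n n' := by
  induction h with
  | refl => exact .refl
  | step _ hl ih => exact (OrderedTree.anc_of_mem_children hl.1).trans ih

/-- The intermediate companion node of clause (ii) lies at or below `c`, hence differs from the
parent `n`, and the clause still applies there. -/
theorem ExtDep.of_localDep {l c n : N} {s' t s : State} (h : ExtDep T l s' c t)
    (hl : T.LocalDep c n t s) : ExtDep T l s' n s := by
  cases h with
  | base h => exact .base (.step h hl)
  | step hm hmc hml ht ht' he hp hd =>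
    refine .step hm ?_ hml ht ht' he hp (.step hd hl)
    rintro rfl
    exact OrderedTree.not_anc_of_mem_children hl.1 hd.anc

/-- A path that stays at or below `c` consists of loops at `c` and a path strictly below `c`. -/
theorem exists_loops_and_path {c : N}
    (ih : ∀ (l : N) (t s' : State), T.tree.IsLeaf l →
      ReflTransGen (fun x y => T.PathStep x y ∧ T.tree.Anc c y.1 ∧ y.1 ≠ c) (c, t) (l, s') →
      t ∈ T.st c → ExtDep T l s' c t)
    {t : State} {x : N × State} (ht : t ∈ T.st c)
    (h : ReflTransGen (fun x y => T.PathStep x y ∧ T.tree.Anc c y.1) (c, t) x) :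
    ∃ t' ∈ T.st c, (t' = t ∨ T.IsCompanionNode c ∧ CompDepPlus T c t' t) ∧
      ReflTransGen (fun x y => T.PathStep x y ∧ T.tree.Anc c y.1 ∧ y.1 ≠ c) (c, t') x := by
  induction h with
  | refl => exact ⟨t, ht, .inl rfl, .refl⟩
  | @tail x y hx hxy IH =>
    obtain ⟨t', ht', hloop, hpath⟩ := IH
    by_cases hy : y.1 = c
    -- From at or below `c`, the node `c` can be re-entered only by a jump from one of its companion
    -- leaves; each such return adds one step of the companion ordering.
    · have hcx : T.tree.Anc c x.1 := by
        rcases ReflTransGen.cases_tail hx with rfl | ⟨_, -, h⟩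
        · exact .refl
        · exact h.2
      obtain ⟨y, u⟩ := y
      obtain ⟨x, u'⟩ := x
      obtain rfl : y = c := hy
      obtain ⟨hstep, -⟩ := hxy
      rcases hstep with hstep | ⟨hcomp, rfl, hu⟩
      · exact absurd hcx (OrderedTree.not_anc_of_mem_children hstep.1)
      · have hext := ih x t' u hcomp.isLeaf hpath ht'
        have huy : u ∈ T.st y := hcomp.1.2.2.2.2 hu
        have hd : CompDep T y u t' := .intro hcomp.isCompanionNode ht' huy hcomp hu hext
        refine ⟨u, huy, .inr ⟨hcomp.isCompanionNode, ?_⟩, .refl⟩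
        rcases hloop with rfl | ⟨-, hloop⟩
        · exact .single hd
        · rw [compDepPlus_iff] at hloop ⊢
          exact TransGen.head hd hloop
    · exact ⟨t', ht', hloop, hpath.tail ⟨hxy.1, hxy.2, hy⟩⟩

/-- A path that ends at a leaf and stays strictly below its first node is an extended dependency. -/
theorem extDep_of_path (n : N) : ∀ (l : N) (s s' : State), T.tree.IsLeaf l →
    ReflTransGen (fun x y => T.PathStep x y ∧ T.tree.Anc n y.1 ∧ y.1 ≠ n) (n, s) (l, s') →
    s ∈ T.st n → ExtDep T l s' n s := by
  induction n using T.tree.wellFounded_children.induction with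
  | _ n ih =>
    intro l s s' hl h hs
    rcases ReflTransGen.cases_head h with h | ⟨⟨c, t⟩, ⟨hstep, hnc, hcn⟩, h⟩
    · cases h
      exact .base (.refl hs)
    · rcases hstep with hstep | ⟨hcomp, -⟩
      · have hpath : ReflTransGen (fun x y => T.PathStep x y ∧ T.tree.Anc c y.1) (c, t) (l, s') ∧
            T.tree.Anc c l := by
          clear hl
          generalize hx : (l, s') = x at h
          suffices H : ReflTransGen (fun x y => T.PathStep x y ∧ T.tree.Anc c y.1) (c, t) x ∧
              T.tree.Anc c x.1 by
            rw [← hx] at H ⊢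
            exact H
          clear hx
          induction h with
          | refl => exact ⟨.refl, .refl⟩
          | @tail x y _ hxy IH =>
            -- A jump leaving the subtree of `c` would land on an ancestor of `n`. Since the path
            -- stays below `n`, that could only be `n`, which is excluded.
            have hy : T.tree.Anc c y.1 := by
              rcases hxy.1 with hxy | hxy'
              · exact IH.2.trans (OrderedTree.anc_of_mem_children hxy.1)
              · rcases IH.2.total hxy'.1.anc with h | h
                · exact h
                · rcases h.eq_or_anc_parent hstep.1 with h | h
                  · rw [h]; exact .refl
                  · exact absurd (h.antisymm hxy.2.1) hxy.2.2
            exact ⟨IH.1.tail ⟨hxy.1, hy⟩, hy⟩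
        obtain ⟨t', ht', hloop, hpath'⟩ := exists_loops_and_path
          (fun l t s' hl h ht => ih c hstep.1 l t s' hl h ht) hstep.2.1 hpath.1
        have hext := ih c hstep.1 l t' s' hl hpath' ht'
        rcases hloop with rfl | ⟨hc, hloop⟩
        · exact hext.of_localDep hstep
        -- Clause (ii) with `c` as the intermediate node: one local step down to `c`, the loops
        -- there, then the path strictly below.
        · refine .step hc hcn ?_ hstep.2.1 ht' hext hloop (.step (.refl hstep.2.1) hstep)
          rintro rfl
          exact hc.not_isLeaf hl
      · exact absurd (hnc.antisymm hcomp.anc).symm hcn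

/-- A nonempty path from `m` to `m` at or below `m` is a descent in the companion-node ordering. -/
theorem compDepPlus_of_path {m : N} {s s' : State} (hs : s ∈ T.st m)
    (h : TransGen (fun x y => T.PathStep x y ∧ T.tree.Anc m y.1) (m, s) (m, s')) :
    CompDepPlus T m s' s := by
  -- The last step back to `m` must be a jump from a companion leaf `l`; it supplies the final step
  -- of the companion ordering after the earlier loops.
  obtain ⟨⟨l, u⟩, h, hstep, -⟩ := TransGen.tail'_iff.1 h
  have hml : T.tree.Anc m l := by
    rcases ReflTransGen.cases_tail h with h | ⟨_, -, h⟩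
    · cases h; exact .refl
    · exact h.2
  rcases hstep with hstep | ⟨hcomp, rfl, hu⟩
  · exact absurd hml (OrderedTree.not_anc_of_mem_children hstep.1)
  · obtain ⟨t', ht', hloop, hpath⟩ := exists_loops_and_path (extDep_of_path m) hs h
    have hd : CompDep T m s' t' := .intro hcomp.isCompanionNode ht' (hcomp.1.2.2.2.2 hu) hcomp hu
      (extDep_of_path m l t' s' hcomp.isLeaf hpath ht')
    rcases hloop with rfl | ⟨-, hloop⟩
    · exact .single hd
    · rw [compDepPlus_iff] at hloop ⊢
      exact TransGen.head hd hloop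

end Paths

/-! ### Traces of refuted states -/

section Traces

universe u

variable {State : Type u} {Act Var N : Type*} [DecidableEq Var] {L : LTS State Act}
  (T : PartialTableau Var N L)

/-- The triple `(n, s, α)` is refuted if `s` belongs to the state set of `n`, but does not satisfy
the formula of `n` when the greatest fixpoint constants are approximated according to `α`. -/
def Refuted (V : Var → Set State) (c : N × State × (Var → Ordinal.{u})) : Prop :=
  c.2.1 ∈ T.st c.1 ∧ c.2.1 ∉ (T.fm c.1).sem L (approxExtend L c.2.2 V (T.dl c.1))

/-- A path step that raises the ordinals of newly introduced constants only, and that lowers the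
ordinal of a greatest fixpoint constant that is unfolded. -/
def TraceStep (c c' : N × State × (Var → Ordinal.{u})) : Prop :=
  T.PathStep (c.1, c.2.1) (c'.1, c'.2.1) ∧
    (∀ U, c'.2.2 U ≤ c.2.2 U ∨ (T.rule c.1 = some .mu ∨ T.rule c.1 = some .nu) ∧
      c'.1 ∈ T.tree.children c.1 ∧ ∃ Φ, T.dl c'.1 = T.dl c.1 ++ [(U, Φ)]) ∧
    ∀ U Z Φ, T.rule c.1 = some .un → T.fm c.1 = .var U → (U, .nu Z Φ) ∈ T.dl c.1 →
      c'.2.2 U < c.2.2 U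

variable {T}

theorem dl_prefix_of_mem_children {n n' : N} (h : n' ∈ T.tree.children n) :
    T.dl n <+: T.dl n' := by
  have hlab : T.label n' ∈ (T.tree.children n).map T.label := List.mem_map_of_mem h
  have hne : T.rule n ≠ none := by
    rw [Ne, T.rule_eq_none, OrderedTree.IsLeaf]
    rintro h'
    rw [h'] at h
    cases h
  obtain ⟨a, ha⟩ := Option.ne_none_iff_exists'.1 hne
  have hok := T.rule_ok n a ha
  have heq : T.dl n' = T.dl n → T.dl n <+: T.dl n' := fun h => h ▸ List.prefix_rfl
  cases a with
  | and | or =>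
    obtain ⟨q₁, q₂, hqs, -, h₁, h₂, -⟩ := hok
    rw [hqs] at hlab
    rcases List.mem_pair.1 hlab with h | h
    · exact heq ((congrArg Sequent.dl h).trans h₁)
    · exact heq ((congrArg Sequent.dl h).trans h₂)
  | box K | dia K f =>
    obtain ⟨q₁, hqs, -, h₁, -⟩ := hok
    rw [hqs] at hlab
    exact heq ((congrArg Sequent.dl (List.mem_singleton.1 hlab)).trans h₁)
  | thin =>
    obtain ⟨q₁, hqs, -, h₁, -⟩ := hok
    rw [hqs] at hlab
    exact heq ((congrArg Sequent.dl (List.mem_singleton.1 hlab)).trans h₁)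
  | un =>
    obtain ⟨q₁, U, Z, Φ, hqs, -, -, h₁, -⟩ := hok
    rw [hqs] at hlab
    exact heq ((congrArg Sequent.dl (List.mem_singleton.1 hlab)).trans h₁)
  | mu | nu =>
    obtain ⟨q₁, U, Z, Φ, hqs, -, h₁, -⟩ := hok
    rw [hqs] at hlab
    exact ⟨_, ((congrArg Sequent.dl (List.mem_singleton.1 hlab)).trans h₁).symm⟩

theorem dl_prefix_of_anc {m n : N} (h : T.tree.Anc m n) : T.dl m <+: T.dl n := by
  induction h using ReflTransGen.head_induction_on with
  | refl => exact List.prefix_rfl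
  | head h _ ih => exact ih.trans (dl_prefix_of_mem_children ((T.tree.mem_children _ _).2 h))

theorem IsCompanionNode.mem_domain {m : N} (h : T.IsCompanionNode m) {U : Var}
    (hU : T.fm m = .var U) : U ∈ domain (T.dl m) := by
  obtain ⟨q₁, U', Z, Φ, -, hU', hΦ, -⟩ := T.rule_ok m _ h
  obtain rfl : U = U' := Formula.var.inj (hU.symm.trans hU')
  rcases hΦ with h | h
  · exact ⟨_, h⟩
  · exact ⟨_, h⟩

theorem IsCandidate.exists_isCompanion {m n : N} (h : T.IsCandidate m n) :
    ∃ m, T.IsCompanion m n :=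
  T.tree.exists_deepest (p := fun m => T.IsCandidate m n) (fun _ h => h.2.2.1.1) ⟨m, h⟩

variable {V : Var → Set State}

/-- A successful leaf with a refuted state has a companion node. -/
theorem exists_isCompanion_of_refuted {n : N} {s : State} {α : Var → Ordinal.{u}}
    (h : T.IsSuccessfulLeaf V n) (hc : T.Refuted V (n, s, α)) : ∃ m, T.IsCompanion m n := by
  obtain ⟨hs, hns⟩ := hc
  rcases h with ⟨Z, hZ, hfm, hsub⟩ | ⟨Z, hZ, hfm, hemp⟩ | ⟨⟨m, hm⟩, -⟩ | ⟨-, m, hm, -⟩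
  · refine absurd ?_ hns
    simp only [hfm, Formula.sem, approxExtend_of_notMem L _ _ hZ]
    exact hsub hs
  · refine absurd ?_ hns
    simp only [hfm, Formula.sem, approxExtend_of_notMem L _ _ hZ]
    intro hsZ
    have : s ∈ T.st n ∩ V Z := ⟨hs, hsZ⟩
    rw [hemp] at this
    exact this
  · exact hm.exists_isCompanion
  · exact ⟨m, hm⟩

/-- Leaf and companion share the same constant, already defined at the companion. Definitions added
between them concern other constants, so its value is the same at both nodes. -/
theorem Refuted.of_isCompanion {m n : N} {s : State} {α : Var → Ordinal.{u}}
    (hc : T.Refuted V (n, s, α)) (hm : T.IsCompanion m n) : T.Refuted V (m, s, α) := by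
  obtain ⟨hs, hns⟩ := hc
  obtain ⟨-, hcm, ⟨hanc, -⟩, ⟨U, -, hUn, hUm⟩, hsub⟩ := hm.1
  refine ⟨hsub hs, ?_⟩
  obtain ⟨Δ, hΔ⟩ := dl_prefix_of_anc hanc
  have hdef : IsDefList (T.dl m ++ Δ) := hΔ ▸ (T.label n).isDefList
  simp only [hUn, ← hΔ, approxExtend_append, Formula.sem] at hns
  rw [approxExtend_of_notMem L _ _ (hdef.notMem_domain_of_append (hcm.mem_domain hUm))] at hns
  simpa only [hUm, Formula.sem] using hns

/-- The step to a child with the same definition list. -/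
theorem exists_traceStep_of_child {n n' : N} {s s' : State} {α : Var → Ordinal.{u}}
    (hrule : T.rule n ≠ some .un) (hdl : T.dl n' = T.dl n) (hdep : T.LocalDep n' n s' s)
    (hs' : s' ∉ (T.fm n').sem L (approxExtend L α V (T.dl n))) :
    ∃ c', T.Refuted V c' ∧ T.TraceStep (n, s, α) c' := by
  refine ⟨(n', s', α), ⟨hdep.2.1, ?_⟩, .inl hdep, fun _ => .inl le_rfl,
    fun U Z Φ h => absurd h hrule⟩
  simpa only [hdl] using hs'

/-- The step from a fixpoint formula to the constant that is introduced for it. -/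
theorem exists_traceStep_of_intro {n n' : N} {s : State} {α : Var → Ordinal.{u}} {U : Var}
    {Φ : Formula Act Var} (hrule : T.rule n = some .mu ∨ T.rule n = some .nu)
    (hmem : n' ∈ T.tree.children n) (hdl : T.dl n' = T.dl n ++ [(U, Φ)])
    (hfm : T.fm n' = .var U) (hdep : T.LocalDep n' n s s)
    (hs : ∃ o, s ∉ approxSem L o (approxExtend L α V (T.dl n)) Φ) :
    ∃ c', T.Refuted V c' ∧ T.TraceStep (n, s, α) c' := by
  obtain ⟨o, ho⟩ := hs
  have hdef : IsDefList (T.dl n ++ [(U, Φ)]) := hdl ▸ (T.label n').isDefList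
  refine ⟨(n', s, Function.update α U o), ⟨hdep.2.1, ?_⟩, .inl hdep, fun Y => ?_,
    fun _ _ _ h => ?_⟩
  -- The new constant differs from all older ones, so choosing its ordinal leaves their values
  -- unchanged.
  · have hcongr : approxExtend L (Function.update α U o) V (T.dl n)
        = approxExtend L α V (T.dl n) := by
      refine approxExtend_congr L V fun Y hY => Function.update_of_ne ?_ _ _
      rintro rfl
      exact hdef.notMem_domain_of_append hY ⟨Φ, by simp⟩
    simpa [hfm, hdl, Formula.sem, approxExtend_append, approxExtend, hcongr] using ho
  · by_cases hY : Y = U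
    · subst hY
      exact .inr ⟨hrule, hmem, Φ, hdl⟩
    · exact .inl (by simp [hY])
  · rcases hrule with h' | h' <;> cases h.symm.trans h'

/-- This is local soundness in contrapositive form. Refutation selects the conjunct or the box
successor; at a disjunction both sides fail and the split of the state set selects; at a diamond
every successor fails, in particular the witness. -/
theorem exists_traceStep (hT : T.IsSuccessful V) {c : N × State × (Var → Ordinal.{u})}
    (hc : T.Refuted V c) : ∃ c', T.Refuted V c' ∧ T.TraceStep c c' := by
  obtain ⟨n, s, α⟩ := c
  cases hr : T.rule n with
  | none =>
    obtain ⟨m, hm⟩ := exists_isCompanion_of_refuted (hT.2 n ((T.rule_eq_none n).1 hr)) hc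
    refine ⟨(m, s, α), hc.of_isCompanion hm, .inr ⟨hm, rfl, hc.1⟩, fun _ => .inl le_rfl, ?_⟩
    intro U Z Φ h
    cases hr.symm.trans h
  | some a =>
    obtain ⟨hs, hns⟩ := hc
    have hok := T.rule_ok n a hr
    have hch : ∀ q ∈ (T.tree.children n).map T.label, ∃ n' ∈ T.tree.children n, T.label n' = q :=
      fun q hq => List.mem_map.1 hq
    dsimp only at hs hns
    cases a with
    | and =>
      obtain ⟨q₁, q₂, hqs, hfm, hd₁, hd₂, hs₁, hs₂⟩ := hok
      rw [hqs] at hch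
      rw [fm, hfm, Formula.sem, Set.mem_inter_iff, not_and_or] at hns
      rcases hns with hns | hns
      · obtain ⟨n', hn', rfl⟩ := hch q₁ (by simp)
        exact exists_traceStep_of_child (by simp [hr]) hd₁
          ⟨hn', by rw [st, hs₁]; exact hs, hs, by simp [hr]⟩ hns
      · obtain ⟨n', hn', rfl⟩ := hch q₂ (by simp)
        exact exists_traceStep_of_child (by simp [hr]) hd₂
          ⟨hn', by rw [st, hs₂]; exact hs, hs, by simp [hr]⟩ hns
    | or =>
      obtain ⟨q₁, q₂, hqs, hfm, hd₁, hd₂, hst⟩ := hok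
      rw [hqs] at hch
      simp only [fm, hfm, Formula.or, Formula.sem, Set.mem_compl_iff, Set.mem_inter_iff,
        not_not] at hns
      have hs' := hs
      rw [st, hst] at hs'
      rcases hs' with hs' | hs'
      · obtain ⟨n', hn', rfl⟩ := hch q₁ (by simp)
        exact exists_traceStep_of_child (by simp [hr]) hd₁ ⟨hn', hs', hs, by simp [hr]⟩ hns.1
      · obtain ⟨n', hn', rfl⟩ := hch q₂ (by simp)
        exact exists_traceStep_of_child (by simp [hr]) hd₂ ⟨hn', hs', hs, by simp [hr]⟩ hns.2
    | box K =>
      obtain ⟨q₁, hqs, hfm, hd, hst⟩ := hok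
      rw [hqs] at hch
      obtain ⟨n', hn', rfl⟩ := hch q₁ (by simp)
      simp only [fm, hfm, Formula.sem, LTS.predBox, Set.mem_ofPred_eq, not_forall] at hns
      obtain ⟨s', hss', hns⟩ := hns
      exact exists_traceStep_of_child (by simp [hr]) hd
        ⟨hn', by rw [st, hst]; exact ⟨s, hs, hss'⟩, hs, by simpa [hr] using hss'⟩ hns
    | dia K f =>
      obtain ⟨q₁, hqs, hfm, hd, hf, hst⟩ := hok
      rw [hqs] at hch
      obtain ⟨n', hn', rfl⟩ := hch q₁ (by simp)
      simp only [fm, hfm, Formula.dia, Formula.sem, LTS.predBox, Set.mem_compl_iff,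
        Set.mem_ofPred_eq, not_not] at hns
      exact exists_traceStep_of_child (by simp [hr]) hd
        ⟨hn', by rw [st, hst]; exact ⟨s, hs, rfl⟩, hs, by simp [hr]⟩ (hns _ (hf s hs))
    | mu =>
      obtain ⟨q₁, U, Z, Φ, hqs, hfm, hd, hfm', hst⟩ := hok
      rw [hqs] at hch
      obtain ⟨n', hn', rfl⟩ := hch q₁ (by simp)
      -- The ordinal `0` is a dummy value, as μ-constants are not approximated.
      refine exists_traceStep_of_intro (.inl hr) hn' hd hfm'
        ⟨hn', by rw [st, hst]; exact hs, hs, by simp [hr]⟩ ⟨0, ?_⟩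
      rwa [fm, hfm] at hns
    | nu =>
      obtain ⟨q₁, U, Z, Φ, hqs, hfm, hd, hfm', hst⟩ := hok
      rw [hqs] at hch
      obtain ⟨n', hn', rfl⟩ := hch q₁ (by simp)
      refine exists_traceStep_of_intro (.inr hr) hn' hd hfm'
        ⟨hn', by rw [st, hst]; exact hs, hs, by simp [hr]⟩ (exists_notMem_approx ?_)
      rwa [fm, hfm] at hns
    | un =>
      obtain ⟨q₁, U, Z, Φ, hqs, hfm, hU, hd, hfm', hst⟩ := hok
      rw [hqs] at hch
      obtain ⟨n', hn', rfl⟩ := hch q₁ (by simp)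
      have hdef := (T.label n).isDefList
      have hdep : T.LocalDep n' n s s := ⟨hn', by rw [st, hst]; exact hs, hs, by simp [hr]⟩
      rw [fm, hfm, Formula.sem] at hns
      rcases hU with hU | hU
      · refine ⟨(n', s, α), ⟨hdep.2.1, ?_⟩, .inl hdep, fun _ => .inl le_rfl, ?_⟩
        · simpa only [fm, hfm', dl, hd] using notMem_unfold_mu L α V hdef hU hns
        · intro U' Z' Φ' _ hU₁ hU₂
          obtain rfl : U = U' := Formula.var.inj (hfm.symm.trans hU₁)
          cases hdef.eq_of_mem hU hU₂
      · obtain ⟨o, ho, hns'⟩ := notMem_unfold_nu L α V hdef hU hns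
        refine ⟨(n', s, Function.update α U o), ⟨hdep.2.1, ?_⟩, .inl hdep, fun Y => .inl ?_, ?_⟩
        · simpa only [fm, hfm', dl, hd] using hns'
        · by_cases hY : Y = U
          · subst hY; simpa using ho.le
          · simp [hY]
        · intro U' Z' Φ' _ hU₁ _
          obtain rfl : U = U' := Formula.var.inj (hfm.symm.trans hU₁)
          simpa using ho
    | thin =>
      obtain ⟨q₁, hqs, hfm, hd, hst⟩ := hok
      rw [hqs] at hch
      obtain ⟨n', hn', rfl⟩ := hch q₁ (by simp)
      exact exists_traceStep_of_child (by simp [hr]) hd ⟨hn', hst hs, hs, by simp [hr]⟩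
        (by rwa [fm, hfm])

-- Infinite traces contradict success

open Filter in
/-- Some node `m` is visited again and again by an infinite path, whose tail stays at or below `m`. -/
theorem exists_recurrent_node {f : ℕ → N × State} (hf : ∀ k, T.PathStep (f k) (f (k + 1))) :
    ∃ m t, (f t).1 = m ∧ (∀ k, ∃ j ≥ k, (f j).1 = m) ∧ ∀ k ≥ t, T.tree.Anc m (f k).1 := by
  have := T.tree.finite
  have hex : ∃ n, ∃ᶠ k in atTop, (f k).1 = n := by
    by_contra! h
    obtain ⟨k, hk⟩ := (eventually_all.2 h).exists
    exact hk _ rfl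
  obtain ⟨m, hm, htop⟩ := T.tree.exists_topmost hex
  have hev : ∀ᶠ k in atTop, ∀ n, (f k).1 = n → ∃ᶠ k in atTop, (f k).1 = n := by
    refine eventually_all.2 fun n => ?_
    by_cases h : ∃ᶠ k in atTop, (f k).1 = n
    · exact .of_forall fun _ _ => h
    · exact (not_frequently.1 h).mono fun k hk hk' => absurd hk' hk
  -- After `t₀` only nodes visited infinitely often occur. A later jump to an ancestor of `m`
  -- therefore lands on `m`, by the topmost choice of `m`.
  obtain ⟨t₀, ht₀⟩ := eventually_atTop.1 hev
  obtain ⟨t, htt₀, ht⟩ := frequently_atTop.1 hm t₀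
  refine ⟨m, t, ht, frequently_atTop.1 hm, fun k hk => ?_⟩
  induction k, hk using Nat.le_induction with
  | base => rw [ht]; exact .refl
  | succ k hk ih =>
    rcases hf k with h | ⟨h, -⟩
    · exact ih.trans (OrderedTree.anc_of_mem_children h.1)
    · rcases ih.total h.anc with h' | h'
      · exact h'
      · rw [htop _ (ht₀ (k + 1) (by omega) _ rfl) h']
        exact .refl

theorem transGen_of_path {f : ℕ → N × State} {m : N} {t : ℕ}
    (hf : ∀ k, T.PathStep (f k) (f (k + 1))) (hm : ∀ k ≥ t, T.tree.Anc m (f k).1) {i j : ℕ}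
    (hi : t ≤ i) (hij : i < j) :
    TransGen (fun x y => T.PathStep x y ∧ T.tree.Anc m y.1) (f i) (f j) := by
  induction j, hij using Nat.le_induction with
  | base => exact .single ⟨hf i, hm _ (by omega)⟩
  | succ j hj ih => exact ih.tail ⟨hf j, hm _ (by omega)⟩

/-- A successful tableau has no infinite trace. -/
theorem IsSuccessful.not_infinite_trace (hT : T.IsSuccessful V)
    {f : ℕ → N × State × (Var → Ordinal.{u})} (hst : ∀ k, (f k).2.1 ∈ T.st (f k).1)
    (hf : ∀ k, T.TraceStep (f k) (f (k + 1))) : False := by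
  obtain ⟨m, t, ht, hrec, hanc⟩ :=
    exists_recurrent_node (f := fun k => ((f k).1, (f k).2.1)) fun k => (hf k).1
  have hdesc : ∀ i ≥ t, ∀ j > i, (f i).1 = m → (f j).1 = m →
      CompDepPlus T m (f j).2.1 (f i).2.1 := by
    intro i hi j hj him hjm
    have h := transGen_of_path (f := fun k => ((f k).1, (f k).2.1)) (fun k => (hf k).1) hanc hi hj
    simp only [him, hjm] at h
    exact compDepPlus_of_path (him ▸ hst i) h
  -- Two visits to `m` give a nonempty descent, and any single step of it comes from a companion
  -- leaf of `m`.
  obtain ⟨l, hl⟩ : ∃ l, T.IsCompanion m l := by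
    obtain ⟨j, hj, hjm⟩ := hrec (t + 1)
    have h := hdesc t le_rfl j hj ht hjm
    have hcomp : ∀ {s' s : State}, CompDep T m s' s → ∃ l, T.IsCompanion m l := by
      rintro s' s ⟨-, -, -, hl, -⟩
      exact ⟨_, hl⟩
    cases h with
    | single h => exact hcomp h
    | tail _ h => exact hcomp h
  obtain ⟨-, hcm, ⟨hml, -⟩, ⟨U, hUl, hfl, hfm⟩, -⟩ := hl.1
  rcases hT.2 l hl.isLeaf with ⟨Z, hZ, hfl', -⟩ | ⟨Z, -, hfl', -⟩ | ⟨-, U', Z, Φ, hfl', hΦ⟩ |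
    ⟨-, m', hm', hwf⟩
  · cases hfl.symm.trans hfl'
    exact hZ hUl
  · cases hfl.symm.trans hfl'
  · cases hfl.symm.trans hfl'
    have hUm : (U, .nu Z Φ) ∈ T.dl m := by
      obtain ⟨Ψ, hΨ⟩ := hcm.mem_domain hfm
      rwa [(T.label l).isDefList.eq_of_mem hΦ ((dl_prefix_of_anc hml).subset hΨ)]
    have hle : ∀ k ≥ t, (f (k + 1)).2.2 U ≤ (f k).2.2 U := by
      intro k hk
      refine ((hf k).2.1 U).resolve_right ?_
      rintro ⟨hr, hmem, Ψ, hdl⟩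
      -- Since `U` occurs at `m`, freshness would place the introducing child above `m`, hence above
      -- its own parent, which lies at or below `m`.
      have hlow := T.fresh _ _ hr hmem U Ψ hdl m (.inl (.inl (by
        have : (T.label m).fm = .var U := hfm
        rw [this]; rfl)))
      exact OrderedTree.not_anc_of_mem_children hmem (hlow.trans (hanc k hk))
    have hanti : ∀ i ≥ t, ∀ j ≥ i, (f j).2.2 U ≤ (f i).2.2 U := by
      intro i hi j hj
      induction j, hj using Nat.le_induction with
      | base => exact le_rfl
      | succ j hj ih => exact (hle j (by omega)).trans ih
    -- Take the least ordinal that `U` attains after `t`; the next visit to `m` unfolds `U` and goes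
    -- below it.
    obtain ⟨-, ⟨k, hk, rfl⟩, hmin⟩ := (wellFounded_lt (α := Ordinal.{u})).has_min
      {o | ∃ k ≥ t, (f k).2.2 U = o} ⟨_, t, le_rfl, rfl⟩
    obtain ⟨j, hj, hjm⟩ := hrec k
    have hjm : (f j).1 = m := hjm
    exact hmin _ ⟨j + 1, by omega, rfl⟩ (((hf j).2.2 U Z Φ (hjm ▸ hcm) (hjm ▸ hfm)
      (hjm ▸ hUm)).trans_le (hanti k hk j hj))
  · obtain rfl := hl.unique hm'
    -- Take a minimal state among the visits to `m` after `t`; any later visit lies strictly below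
    -- it in the transitive closure.
    obtain ⟨-, ⟨i, hi, him, rfl⟩, hmin⟩ := hwf.transGen.has_min
      {s | ∃ i ≥ t, (f i).1 = m ∧ (f i).2.1 = s} ⟨_, t, le_rfl, ht, rfl⟩
    obtain ⟨j, hj, hjm⟩ := hrec (i + 1)
    exact hmin _ ⟨j, by omega, hjm, rfl⟩
      ((compDepPlus_iff _ _ _ _).1 (hdesc i hi j (by omega) him hjm))

theorem IsSuccessful.not_refuted (hT : T.IsSuccessful V) (c : N × State × (Var → Ordinal.{u})) :
    ¬ T.Refuted V c := by
  intro hc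
  have hnext : ∀ c : {c // T.Refuted V c}, ∃ c' : {c // T.Refuted V c}, T.TraceStep c.1 c'.1 := by
    rintro ⟨c, hc⟩
    obtain ⟨c', hc', h⟩ := exists_traceStep hT hc
    exact ⟨⟨c', hc'⟩, h⟩
  choose g hg using hnext
  refine hT.not_infinite_trace (f := fun k => (g^[k] ⟨c, hc⟩).1) (fun k => (g^[k] ⟨c, hc⟩).2.1)
    fun k => ?_
  rw [Function.iterate_succ_apply']
  exact hg _

end Traces

end PartialTableau

end MuCalc

/-- Soundness: if a successful tableau has the root sequent `q = S ⊢_Δ Φ` with `Δ` empty, then `q`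
is valid, i.e. `S ⊆ ⟦Φ⟧_V`. -/
theorem mainTheorem1 {State Act Var N : Type*} [DecidableEq Var] [Countable Var] [Infinite Var]
    (L : MuCalc.LTS State Act) (V : Var → Set State) (T : MuCalc.PartialTableau Var N L)
    (q : MuCalc.Sequent State Act Var) (hdl : q.dl = [])
    (hroot : T.label T.tree.root = q) (hT : T.IsSuccessful V) :
    q.Valid L V := by
  subst hroot
  intro s hs
  by_contra hns
  -- The initial ordinals are arbitrary, since no constant is defined at the root.
  refine hT.not_refuted (T.tree.root, s, fun _ => 0) ⟨hs, ?_⟩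
  simp only [MuCalc.PartialTableau.dl, hdl, MuCalc.approxExtend]
  simpa only [MuCalc.Sequent.sem, hdl, MuCalc.extend, MuCalc.PartialTableau.fm] using hns
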